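/- Let $d$ and $k$ be integers with $1\le k\le \frac d2$. Let $\Delta_{d,k}\subset\mathbb R^d$ be the $(k,d)$-hypersimplex, i.e. the convex hull of all $(0,1)$-vectors in $\mathbb R^d$ whose entries sum to $k$, and let $G_{d,k}$ be its graph: its vertices are the vertices (extreme points) of $\Delta_{d,k}$, and two distinct vertices $x,y$ are adjacent if for no $\lambda$ with $0<\lambda<1$ is $\lambda x+(1-\lambda)y$ a convex combination of vertices of $\Delta_{d,k}$ other than $x$ and $y$. Then: (a) $G_{d,k}$ is $(d-1)$-connected, that is, for every two distinct vertices $x$ and $y$ of $G_{d,k}$ there are $d-1$ different paths from $x$ to $y$ in $G_{d,k}$ that pairwise have no vertex in common except $x$ and $y$; (b) $G_{d,k}$ is Hamilton connected, that is, every two distinct vertices of $G_{d,k}$ are joined by a path that passes through every vertex of $G_{d,k}$ exactly once. -/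

import Mathlib

namespace HypersimplexGraph

/-- The `(k,d)`-hypersimplex: the convex hull of all `(0,1)`-vectors in `ℝ^d` whose entries
sum to `k`. -/
def hypersimplex (d k : ℕ) : Set (Fin d → ℝ) :=
  convexHull ℝ {x | (∀ i, x i = 0 ∨ x i = 1) ∧ ∑ i, x i = (k : ℝ)}

/-- The graph of a convex polytope `P`. Its vertices are the vertices (extreme points) of `P`.
Two distinct vertices `x`, `y` are adjacent if no point `a • x + b • y` with `0 < a`, `0 < b`,
`a + b = 1` is a convex combination of vertices of `P` other than `x` and `y`. -/
def polytopeGraph {E : Type*} [AddCommGroup E] [Module ℝ E] (P : Set E) :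
    SimpleGraph (P.extremePoints ℝ) where
  Adj x y := x ≠ y ∧
    Disjoint (openSegment ℝ (x : E) (y : E))
      (convexHull ℝ (P.extremePoints ℝ \ {(x : E), (y : E)}))
  symm := ⟨fun x y h => ⟨h.1.symm, by
    rw [openSegment_symm, Set.pair_comm]
    exact h.2⟩⟩
  loopless := ⟨fun _ h => h.1 rfl⟩

/-- The graph of the hypersimplex. -/
def hypersimplexGraph (d k : ℕ) : SimpleGraph ((hypersimplex d k).extremePoints ℝ) :=
  polytopeGraph (hypersimplex d k)

/-- `G` is `m`-connected: any two distinct vertices `x`, `y` are joined by `m` different paths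
that pairwise have only the end vertices `x` and `y` in common. -/
def IsVertexConnected {V : Type*} (G : SimpleGraph V) (m : ℕ) : Prop :=
  ∀ x y : V, x ≠ y → ∃ p : Fin m → G.Path x y, Function.Injective p ∧
    ∀ i j : Fin m, i ≠ j → ∀ v : V,
      v ∈ (p i : G.Walk x y).support → v ∈ (p j : G.Walk x y).support → v = x ∨ v = y

open Classical in
/-- `G` is Hamilton connected: any two distinct vertices are joined by a path that passes through
every vertex of `G` exactly once. -/
def IsHamiltonConnected {V : Type*} (G : SimpleGraph V) : Prop :=
  ∀ x y : V, x ≠ y → ∃ p : G.Walk x y, p.IsHamiltonian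

end HypersimplexGraph

/-! Vertices of the hypersimplex are indicator vectors of `k`-sets, and exchanging one element gives
an edge (`hypersimplexGraph_adj_of_johnson_adj`). Both claims concern the existence of paths, so it
suffices to find them in the Johnson graph and lift them by `exists_walk_of_johnson_walk`.

Hamilton connectedness is an induction over the slices of `k`-sets between `A` and `B`: for `i ∈ x \
y`, traverse the sets containing `i`, starting at `x`, exchange `i` for another element, then
traverse the sets avoiding `i`, ending at `y`.

For connectivity let `m = |x \ y|`. Cyclically ordering `x \ y` and `y \ x` and exchanging them one
by one from chosen starting points gives `m²` paths. Each of the `d - 2m` elements `c` outside the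
symmetric difference gives one more, whose inner vertices have the status of `c` flipped
(`exists_path_toggling`). All are internally disjoint, and `m² + d - 2m = (m - 1)² + d - 1`. -/

namespace HypersimplexGraph

open Finset

/-! ### Hamiltonian and toggling paths in Johnson graphs -/

section Johnson

variable {α : Type*} [DecidableEq α]

/-- The disjoint union of all Johnson graphs on `α`: two finite sets are adjacent if one arises
from the other by exchanging a single element. -/
def johnson (α : Type*) [DecidableEq α] : SimpleGraph (Finset α) where
  Adj s t := (s \ t).card = 1 ∧ (t \ s).card = 1
  symm := ⟨fun _ _ h => ⟨h.2, h.1⟩⟩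
  loopless := ⟨fun s h => by simp at h⟩

theorem johnson_adj_exchange {s : Finset α} {a b : α} (ha : a ∈ s) (hb : b ∉ s) :
    (johnson α).Adj s (insert b (s.erase a)) := by
  have hab : a ≠ b := fun h => hb (h ▸ ha)
  constructor
  · rw [card_eq_one]
    refine ⟨a, ?_⟩
    ext e
    simp only [mem_sdiff, mem_insert, mem_erase, mem_singleton]
    grind
  · rw [card_eq_one]
    refine ⟨b, ?_⟩
    ext e
    simp only [mem_sdiff, mem_insert, mem_erase, mem_singleton]
    grind

theorem johnson_adj_card_eq {s t : Finset α} (h : (johnson α).Adj s t) : s.card = t.card := by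
  have h₁ := card_sdiff_add_card_inter s t
  have h₂ := card_sdiff_add_card_inter t s
  rw [h.1] at h₁
  rw [h.2, inter_comm] at h₂
  omega

theorem card_insert_erase {s : Finset α} {a b : α} (ha : a ∈ s) (hb : b ∉ s) :
    (insert b (s.erase a)).card = s.card :=
  (johnson_adj_card_eq (johnson_adj_exchange ha hb)).symm

theorem exists_mem_notMem_of_card_eq {x y : Finset α} (hc : x.card = y.card) (h : x ≠ y) :
    ∃ i ∈ x, i ∉ y := by
  by_contra! H
  exact h (eq_of_subset_of_card_le H hc.ge)

/-- The sets of size `k` between `A` and `B`. -/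
def slice (A B : Finset α) (k : ℕ) : Set (Finset α) :=
  {s | A ⊆ s ∧ s ⊆ B ∧ s.card = k}

/-- Every slice is Hamilton connected. -/
theorem exists_hamiltonian_path_slice (A B : Finset α) (k : ℕ) (x y : Finset α)
    (hx : x ∈ slice A B k) (hy : y ∈ slice A B k) (hxy : x ≠ y ∨ ∀ z ∈ slice A B k, z = x) :
    ∃ p : (johnson α).Walk x y, p.IsPath ∧ ∀ s, s ∈ p.support ↔ s ∈ slice A B k := by
  induction hn : (B \ A).card using Nat.strong_induction_on generalizing A B x y with
  | _ n ih =>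
  -- A one-element slice is traversed by the trivial path; the second alternative of `hxy` admits
  -- it, since either half of a split may be a singleton.
  by_cases hne : x = y
  · subst hne
    have hs : ∀ z ∈ slice A B k, z = x := hxy.resolve_left (fun h => h rfl)
    refine ⟨.nil, .nil, fun s => ?_⟩
    simp only [SimpleGraph.Walk.support_nil, List.mem_singleton]
    exact ⟨fun h => h ▸ hx, hs s⟩
  obtain ⟨i, hix, hiy⟩ := exists_mem_notMem_of_card_eq (hx.2.2.trans hy.2.2.symm) hne
  have hiB : i ∈ B := hx.2.1 hix
  have hiA : i ∉ A := fun h => hiy (hy.1 h)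
  have lt₁ : (B \ insert i A).card < n := by
    rw [← hn]
    apply card_lt_card
    refine ssubset_iff_of_subset (sdiff_subset_sdiff subset_rfl (subset_insert i A)) |>.2
      ⟨i, by simp [hiB, hiA], by simp⟩
  have lt₀ : (B.erase i \ A).card < n := by
    rw [← hn]
    apply card_lt_card
    refine ssubset_iff_of_subset (sdiff_subset_sdiff (erase_subset i B) subset_rfl) |>.2
      ⟨i, by simp [hiB, hiA], by simp⟩
  have hx₁ : x ∈ slice (insert i A) B k := ⟨insert_subset hix hx.1, hx.2.1, hx.2.2⟩
  have hy₀ : y ∈ slice A (B.erase i) k := ⟨hy.1, subset_erase.2 ⟨hy.2.1, hiy⟩, hy.2.2⟩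
  obtain ⟨x', hx', hxx'⟩ : ∃ x' ∈ slice (insert i A) B k,
      x ≠ x' ∨ ∀ z ∈ slice (insert i A) B k, z = x := by
    by_cases h : ∃ z ∈ slice (insert i A) B k, z ≠ x
    · obtain ⟨z, hz, hzx⟩ := h
      exact ⟨z, hz, .inl hzx.symm⟩
    · push Not at h
      exact ⟨x, hx₁, .inr h⟩
  have hix' : i ∈ x' := hx'.1 (mem_insert_self i A)
  have mem₀ : ∀ j ∈ B, j ∉ x' → insert j (x'.erase i) ∈ slice A (B.erase i) k := by
    intro j hj hjx
    have hji : j ≠ i := fun h => hjx (h ▸ hix')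
    refine ⟨fun e he => ?_, fun e he => ?_, (card_insert_erase hix' hjx).trans hx'.2.2⟩
    · have : e ∈ x' := hx'.1 (mem_insert_of_mem he)
      have : e ≠ i := fun h => hiA (h ▸ he)
      simp [*]
    · rcases mem_insert.1 he with rfl | he
      · exact mem_erase.2 ⟨hji, hj⟩
      · exact mem_erase.2 ⟨(mem_erase.1 he).1, hx'.2.1 (mem_erase.1 he).2⟩
  -- Two elements of `B` outside `x'` give two neighbours without `i`, one of them different from
  -- `y`. If there is only one such element, `B.erase i` has size `k` and the half avoiding `i` is a
  -- singleton.
  obtain ⟨y', hy', hadj, hyy'⟩ : ∃ y' ∈ slice A (B.erase i) k, (johnson α).Adj x' y' ∧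
      (y' ≠ y ∨ ∀ z ∈ slice A (B.erase i) k, z = y') := by
    obtain ⟨j, hjy, hjx⟩ := exists_mem_notMem_of_card_eq (hy.2.2.trans hx'.2.2.symm)
      (fun h => hiy (h ▸ hix'))
    have hjB : j ∈ B := hy.2.1 hjy
    by_cases h : ∃ l ∈ B, l ∉ x' ∧ l ≠ j
    · obtain ⟨l, hlB, hlx, hlj⟩ := h
      by_cases hj : insert j (x'.erase i) = y
      · refine ⟨_, mem₀ l hlB hlx, johnson_adj_exchange hix' hlx, .inl fun h => ?_⟩
        rw [← hj] at h
        have : l ∈ insert j (x'.erase i) := h ▸ mem_insert_self l _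
        simp [hlj, hlx] at this
      · exact ⟨_, mem₀ j hjB hjx, johnson_adj_exchange hix' hjx, .inl hj⟩
    · push Not at h
      refine ⟨_, mem₀ j hjB hjx, johnson_adj_exchange hix' hjx, .inr fun z hz => ?_⟩
      refine eq_of_subset_of_card_le (fun e he => ?_)
        ((mem₀ j hjB hjx).2.2.trans hz.2.2.symm).le
      have := mem_erase.1 (hz.2.1 he)
      grind
  obtain ⟨p, hp, hps⟩ := ih _ lt₁ (insert i A) B x x' hx₁ hx' hxx' rfl
  obtain ⟨q, hq, hqs⟩ := ih _ lt₀ A (B.erase i) y' y hy' hy₀ hyy' rfl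
  have hsupp : (p.append (.cons hadj q)).support = p.support ++ q.support := by
    simp [SimpleGraph.Walk.support_append]
  refine ⟨p.append (.cons hadj q), ?_, fun s => ?_⟩
  · rw [SimpleGraph.Walk.isPath_def, hsupp, List.nodup_append']
    refine ⟨hp.support_nodup, hq.support_nodup, fun s hs hs' => ?_⟩
    have h₁ := ((hps s).1 hs).1 (mem_insert_self i A)
    have h₂ := ((hqs s).1 hs').2.1 h₁
    simp at h₂
  · rw [hsupp, List.mem_append, hps, hqs]
    simp only [slice, Set.mem_ofPred_eq, insert_subset_iff, subset_erase]
    have := @hiA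
    tauto

theorem exists_path_slice {A B : Finset α} {k : ℕ} {x y : Finset α}
    (hx : x ∈ slice A B k) (hy : y ∈ slice A B k) :
    ∃ p : (johnson α).Walk x y, p.IsPath ∧ ∀ s ∈ p.support, s ∈ slice A B k := by
  by_cases h : x = y
  · subst h
    exact ⟨.nil, .nil, by simpa using hx⟩
  · obtain ⟨p, hp, hs⟩ := exists_hamiltonian_path_slice A B k x y hx hy (.inl h)
    exact ⟨p, hp, fun s => (hs s).1⟩

/-- Join `x'` to `y'` inside the slice; as `x` and `y` lie outside it, attaching them keeps the walk
a path. -/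
theorem exists_path_through_slice {A B : Finset α} {k : ℕ} {x y x' y' : Finset α} (hxy : x ≠ y)
    (hx' : x' ∈ slice A B k) (hy' : y' ∈ slice A B k) (hx : x ∉ slice A B k)
    (hy : y ∉ slice A B k) (hxx' : (johnson α).Adj x x') (hyy' : (johnson α).Adj y y') :
    ∃ p : (johnson α).Walk x y, p.IsPath ∧
      (∀ v ∈ p.support, v ≠ x → v ≠ y → v ∈ slice A B k) ∧
      ∃ v ∈ p.support, v ≠ x ∧ v ≠ y := by
  obtain ⟨q, hq, hqs⟩ := exists_path_slice hx' hy'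
  have hsupp : (SimpleGraph.Walk.cons hxx' (q.concat hyy'.symm)).support
      = x :: (q.support ++ [y]) := by
    simp [SimpleGraph.Walk.support_concat]
  refine ⟨.cons hxx' (q.concat hyy'.symm), ?_, ?_, x', ?_, ?_, ?_⟩
  · rw [SimpleGraph.Walk.isPath_def, hsupp, List.nodup_cons, List.nodup_append']
    refine ⟨?_, hq.support_nodup, by simp, ?_⟩
    · simp only [List.mem_append, List.mem_singleton, not_or]
      exact ⟨fun h => hx (hqs x h), hxy⟩
    · intro s hs hs'
      rw [List.mem_singleton] at hs'
      exact hy (hs' ▸ hqs s hs)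
  · intro v hv hvx hvy
    rw [hsupp] at hv
    simp only [List.mem_cons, List.mem_append, List.not_mem_nil, or_false] at hv
    exact hqs v (by tauto)
  · simp [hsupp]
  · exact fun h => hx (h ▸ hx')
  · exact fun h => hy (h ▸ hx')

/-- For every `c` outside the symmetric difference of `x` and `y` there is a path from `x` to `y`
whose inner vertices differ from `x` outside that symmetric difference exactly at `c`. -/
theorem exists_path_toggling {x y : Finset α} (hc : x.card = y.card) (hxy : x ≠ y) {c : α}
    (hcxy : c ∈ x ↔ c ∈ y) :
    ∃ p : (johnson α).Walk x y, p.IsPath ∧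
      (∀ v ∈ p.support, v ≠ x → v ≠ y →
        ∀ e, (e ∈ x ↔ e ∈ y) → ((e ∈ v ↔ e ∈ x) ↔ e ≠ c)) ∧
      ∃ v ∈ p.support, v ≠ x ∧ v ≠ y := by
  obtain ⟨a, hax, hay⟩ := exists_mem_notMem_of_card_eq hc hxy
  obtain ⟨b, hby, hbx⟩ := exists_mem_notMem_of_card_eq hc.symm hxy.symm
  by_cases hcx : c ∈ x
  · have hcy := hcxy.1 hcx
    -- Members of this slice agree with `x` and `y` off the symmetric difference, except that they
    -- lack `c`.
    obtain ⟨p, hp, hs, hi⟩ := exists_path_through_slice (A := (x ∩ y).erase c)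
      (B := (x ∪ y).erase c) (k := x.card) hxy
      (x' := insert b (x.erase c)) (y' := insert a (y.erase c))
      ⟨by intro e; simp only [mem_insert, mem_erase, mem_inter]; tauto,
        by intro e; simp only [mem_insert, mem_erase, mem_union]; grind,
        card_insert_erase hcx hbx⟩
      ⟨by intro e; simp only [mem_insert, mem_erase, mem_inter]; tauto,
        by intro e; simp only [mem_insert, mem_erase, mem_union]; grind,
        (card_insert_erase hcy hay).trans hc.symm⟩
      (fun h => by simpa using h.2.1 hcx) (fun h => by simpa using h.2.1 hcy)
      (johnson_adj_exchange hcx hbx) (johnson_adj_exchange hcy hay)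
    refine ⟨p, hp, fun v hv hvx hvy e he => ?_, hi⟩
    obtain ⟨h₁, h₂, -⟩ := hs v hv hvx hvy
    have h₁ := @h₁ e
    have h₂ := @h₂ e
    simp only [mem_erase, mem_inter, mem_union] at h₁ h₂
    by_cases hec : e = c
    · subst hec; tauto
    · tauto
  · have hcy : c ∉ y := fun h => hcx (hcxy.2 h)
    obtain ⟨p, hp, hs, hi⟩ := exists_path_through_slice (A := insert c (x ∩ y))
      (B := insert c (x ∪ y)) (k := x.card) hxy
      (x' := insert c (x.erase a)) (y' := insert c (y.erase b))
      ⟨by intro e; simp only [mem_insert, mem_erase, mem_inter]; grind,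
        by intro e; simp only [mem_insert, mem_erase, mem_union]; tauto,
        card_insert_erase hax hcx⟩
      ⟨by intro e; simp only [mem_insert, mem_erase, mem_inter]; grind,
        by intro e; simp only [mem_insert, mem_erase, mem_union]; tauto,
        (card_insert_erase hby hcy).trans hc.symm⟩
      (fun h => hcx (h.1 (mem_insert_self c _))) (fun h => hcy (h.1 (mem_insert_self c _)))
      (johnson_adj_exchange hax hcx) (johnson_adj_exchange hby hcy)
    refine ⟨p, hp, fun v hv hvx hvy e he => ?_, hi⟩
    obtain ⟨h₁, h₂, -⟩ := hs v hv hvx hvy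
    have h₁ := @h₁ e
    have h₂ := @h₂ e
    simp only [mem_insert, mem_inter, mem_union] at h₁ h₂
    by_cases hec : e = c
    · subst hec; tauto
    · tauto

end Johnson

theorem exists_walk_support_eq_map_range {V : Type*} (G : SimpleGraph V) (f : ℕ → V) (n : ℕ)
    (h : ∀ t < n, G.Adj (f t) (f (t + 1))) :
    ∃ p : G.Walk (f 0) (f n), p.support = (List.range (n + 1)).map f := by
  induction n with
  | zero => exact ⟨.nil, by simp⟩
  | succ n ih =>
    obtain ⟨p, hp⟩ := ih fun t ht => h t (by omega)
    refine ⟨p.concat (h n (by omega)), ?_⟩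
    rw [SimpleGraph.Walk.support_concat, hp, List.range_succ (n := n + 1)]
    simp

theorem isHamiltonConnected_of_exists_isPath {V : Type*} {G : SimpleGraph V}
    (h : ∀ x y : V, x ≠ y → ∃ p : G.Walk x y, p.IsPath ∧ ∀ w, w ∈ p.support) :
    IsHamiltonConnected G := by
  classical
  intro x y hxy
  obtain ⟨p, hp, hs⟩ := h x y hxy
  exact ⟨p, hp.isHamiltonian_of_mem hs⟩

/-! ### Paths by cyclic exchange -/

section CyclicInterval

variable {m : ℕ}

/-- The cyclic interval `{z, z + 1, …, z + t - 1}`. -/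
def cyclicInterval (z : ZMod m) (t : ℕ) : Finset (ZMod m) :=
  (range t).image fun u : ℕ => z + (u : ZMod m)

theorem cyclicInterval_zero (z : ZMod m) : cyclicInterval z 0 = ∅ := rfl

theorem cyclicInterval_succ (z : ZMod m) (t : ℕ) :
    cyclicInterval z (t + 1) = insert (z + (t : ZMod m)) (cyclicInterval z t) := by
  simp [cyclicInterval, range_add_one]

theorem card_cyclicInterval (z : ZMod m) {t : ℕ} (ht : t ≤ m) :
    (cyclicInterval z t).card = t := by
  rw [cyclicInterval, card_image_of_injOn, card_range]
  intro u hu v hv h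
  simp only [coe_range, Set.mem_Iio, add_right_inj] at hu hv h
  rw [ZMod.natCast_eq_natCast_iff] at h
  exact h.eq_of_lt_of_lt (by omega) (by omega)

theorem add_natCast_notMem_cyclicInterval (z : ZMod m) {t : ℕ} (ht : t < m) :
    z + (t : ZMod m) ∉ cyclicInterval z t := by
  intro h
  have h₁ := card_cyclicInterval z (t := t + 1) ht
  rw [cyclicInterval_succ, insert_eq_of_mem h, card_cyclicInterval z ht.le] at h₁
  omega

theorem cyclicInterval_self [NeZero m] (z : ZMod m) : cyclicInterval z m = univ := by
  rw [← card_eq_iff_eq_univ, card_cyclicInterval z le_rfl, ZMod.card]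

theorem sub_one_notMem_cyclicInterval (z : ZMod m) {t : ℕ} (ht : t < m) :
    z - 1 ∉ cyclicInterval z t := by
  simp only [cyclicInterval, mem_image, mem_range, not_exists, not_and]
  intro u hu h
  have h₁ : ((u + 1 : ℕ) : ZMod m) = 0 := by
    push_cast
    linear_combination h
  rw [ZMod.natCast_eq_zero_iff] at h₁
  have := Nat.le_of_dvd (by omega) h₁
  omega

/-- A nonempty proper cyclic interval has exactly one element whose predecessor is missing, namely
its start. -/
theorem cyclicInterval_left_injective {z w : ZMod m} {t : ℕ} (h0 : t ≠ 0) (ht : t < m)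
    (h : cyclicInterval z t = cyclicInterval w t) : z = w := by
  have hz : z ∈ cyclicInterval w t := by
    rw [← h]
    exact mem_image.2 ⟨0, by simp; omega, by simp⟩
  obtain ⟨u, hu, rfl⟩ := mem_image.1 hz
  rw [mem_range] at hu
  rcases u with _ | u
  · simp
  · refine absurd ?_
      (sub_one_notMem_cyclicInterval (w + ((u + 1 : ℕ) : ZMod m)) ht)
    rw [h]
    exact mem_image.2 ⟨u, by simp; omega, by push_cast; ring⟩

variable {α : Type*} [DecidableEq α]

/-- The set obtained from `x` by exchanging the elements of `a` in the cyclic interval of length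
`t` from `p` for the elements of `b` in the cyclic interval of length `t` from `q`. -/
def cyclicExchange (x : Finset α) (a b : ZMod m ↪ α) (p q : ZMod m) (t : ℕ) : Finset α :=
  (x \ (cyclicInterval p t).map a) ∪ (cyclicInterval q t).map b

variable {x y : Finset α} {a b : ZMod m ↪ α} (ha : ∀ z, a z ∈ x \ y) (hb : ∀ z, b z ∈ y \ x)

include hb

theorem right_mem_cyclicExchange (p q z : ZMod m) (t : ℕ) :
    b z ∈ cyclicExchange x a b p q t ↔ z ∈ cyclicInterval q t := by
  simp [cyclicExchange, (mem_sdiff.1 (hb z)).2]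

include ha

theorem left_mem_cyclicExchange (p q z : ZMod m) (t : ℕ) :
    a z ∈ cyclicExchange x a b p q t ↔ z ∉ cyclicInterval p t := by
  have h₁ := mem_sdiff.1 (ha z)
  have h₂ : ∀ w, b w ≠ a z := fun w h => h₁.2 (h ▸ (mem_sdiff.1 (hb w)).1)
  simp [cyclicExchange, h₁.1, h₂]

theorem mem_cyclicExchange_of_mem_iff (p q : ZMod m) (t : ℕ) {e : α} (he : e ∈ x ↔ e ∈ y) :
    e ∈ cyclicExchange x a b p q t ↔ e ∈ x := by
  have h₁ : ∀ w, a w ≠ e := fun w h => by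
    have := mem_sdiff.1 (ha w)
    rw [h] at this
    tauto
  have h₂ : ∀ w, b w ≠ e := fun w h => by
    have := mem_sdiff.1 (hb w)
    rw [h] at this
    tauto
  simp [cyclicExchange, h₁, h₂]

theorem cyclicExchange_adj (p q : ZMod m) {t : ℕ} (ht : t < m) :
    (johnson α).Adj (cyclicExchange x a b p q t) (cyclicExchange x a b p q (t + 1)) := by
  have h₁ := (left_mem_cyclicExchange ha hb p q (p + t) t).2
    (add_natCast_notMem_cyclicInterval p ht)
  have h₂ := mt (right_mem_cyclicExchange (a := a) hb p q (q + t) t).1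
    (add_natCast_notMem_cyclicInterval q ht)
  convert johnson_adj_exchange h₁ h₂ using 1
  have h₃ : ∀ w, b w ≠ a (p + t) := fun w h =>
    (mem_sdiff.1 (ha (p + t))).2 (h ▸ (mem_sdiff.1 (hb w)).1)
  rw [cyclicExchange, cyclicExchange, cyclicInterval_succ, cyclicInterval_succ, map_insert,
    map_insert]
  ext e
  have h₄ : e ∈ (cyclicInterval q t).map b → e ≠ a (p + t) := by
    rintro h rfl
    obtain ⟨w, -, hw⟩ := mem_map.1 h
    exact h₃ w hw
  simp only [mem_union, mem_sdiff, mem_insert, mem_erase]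
  tauto

theorem cyclicExchange_self [NeZero m] (hx : (x \ y).card = m) (hy : (y \ x).card = m)
    (p q : ZMod m) : cyclicExchange x a b p q m = y := by
  have h₁ : univ.map a = x \ y := by
    refine eq_of_subset_of_card_le (fun e he => ?_) (by simp [hx, ZMod.card])
    obtain ⟨w, -, rfl⟩ := mem_map.1 he
    exact ha w
  have h₂ : univ.map b = y \ x := by
    refine eq_of_subset_of_card_le (fun e he => ?_) (by simp [hy, ZMod.card])
    obtain ⟨w, -, rfl⟩ := mem_map.1 he
    exact hb w
  rw [cyclicExchange, cyclicInterval_self, cyclicInterval_self, h₁, h₂]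
  ext e
  simp only [mem_union, mem_sdiff]
  tauto

/-- The traces of the set on `x \ y` and `y \ x` recover both intervals, hence their length and, for
inner vertices, their starts. This makes the `m²` paths internally disjoint. -/
theorem cyclicExchange_eq {p q p' q' : ZMod m} {t t' : ℕ} (ht : t ≤ m) (ht' : t' ≤ m)
    (h : cyclicExchange x a b p q t = cyclicExchange x a b p' q' t') :
    t = t' ∧ (t ≠ 0 → t ≠ m → p = p' ∧ q = q') := by
  have h₁ : cyclicInterval q t = cyclicInterval q' t' := by
    ext z
    rw [← right_mem_cyclicExchange hb p q, h, right_mem_cyclicExchange hb]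
  have h₂ : cyclicInterval p t = cyclicInterval p' t' := by
    ext z
    rw [← not_iff_not, ← left_mem_cyclicExchange ha hb p q, h, left_mem_cyclicExchange ha hb]
  have h₃ : t = t' := by
    rw [← card_cyclicInterval q ht, h₁, card_cyclicInterval q' ht']
  subst h₃
  exact ⟨rfl, fun h0 hm => ⟨cyclicInterval_left_injective h0 (by omega) h₂,
    cyclicInterval_left_injective h0 (by omega) h₁⟩⟩

theorem exists_path_cyclicExchange [NeZero m] (hx : (x \ y).card = m) (hy : (y \ x).card = m)
    (p q : ZMod m) : ∃ w : (johnson α).Walk x y, w.IsPath ∧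
      ∀ v, v ∈ w.support ↔ ∃ t ≤ m, cyclicExchange x a b p q t = v := by
  obtain ⟨w, hw⟩ := exists_walk_support_eq_map_range (johnson α) (cyclicExchange x a b p q) m
    fun t ht => cyclicExchange_adj ha hb p q ht
  have h0 : cyclicExchange x a b p q 0 = x := by simp [cyclicExchange, cyclicInterval_zero]
  refine ⟨w.copy h0 (cyclicExchange_self ha hb hx hy p q), ?_, fun v => ?_⟩
  · rw [SimpleGraph.Walk.isPath_def, SimpleGraph.Walk.support_copy, hw]
    refine List.Nodup.map_on (fun t ht t' ht' h => ?_) List.nodup_range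
    rw [List.mem_range] at ht ht'
    exact (cyclicExchange_eq ha hb (by omega) (by omega) h).1
  · simp [hw, Order.lt_add_one_iff]

end CyclicInterval

/-! ### Counting disjoint paths in the Johnson graph -/

theorem exists_disjoint_paths {α : Type*} [Fintype α] [DecidableEq α] {x y : Finset α}
    (hc : x.card = y.card) (hxy : x ≠ y) :
    ∃ P : Fin (Fintype.card α - 1) → (johnson α).Path x y, Function.Injective P ∧
      ∀ i j, i ≠ j → ∀ v, v ∈ (P i : (johnson α).Walk x y).support →
        v ∈ (P j : (johnson α).Walk x y).support → v = x ∨ v = y := by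
  obtain ⟨m, hx⟩ : ∃ m, (x \ y).card = m := ⟨_, rfl⟩
  have hy : (y \ x).card = m := by rw [← hx, card_sdiff_comm hc]
  have hm : m ≠ 0 := by
    obtain ⟨i, hix, hiy⟩ := exists_mem_notMem_of_card_eq hc hxy
    rw [← hx]
    exact card_ne_zero_of_mem (mem_sdiff.2 ⟨hix, hiy⟩)
  have : NeZero m := ⟨hm⟩
  have ea : ZMod m ≃ ↥(x \ y) := Fintype.equivOfCardEq (by rw [ZMod.card, Fintype.card_coe, hx])
  have eb : ZMod m ≃ ↥(y \ x) := Fintype.equivOfCardEq (by rw [ZMod.card, Fintype.card_coe, hy])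
  let a : ZMod m ↪ α := ea.toEmbedding.trans (Function.Embedding.subtype _)
  let b : ZMod m ↪ α := eb.toEmbedding.trans (Function.Embedding.subtype _)
  have ha : ∀ z, a z ∈ x \ y := fun z => (ea z).2
  have hb : ∀ z, b z ∈ y \ x := fun z => (eb z).2
  choose W hWp hWs using fun r : ZMod m × ZMod m =>
    exists_path_cyclicExchange ha hb hx hy r.1 r.2
  choose T hTp hTs hTi using fun c : {c // c ∈ (symmDiff x y)ᶜ} =>
    exists_path_toggling hc hxy (c := c) (by
      have := c.2
      simp only [mem_compl, mem_symmDiff] at this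
      tauto)
  have hWi : ∀ r, ∀ v ∈ (W r).support, v ≠ x → v ≠ y →
      ∃ t, t ≠ 0 ∧ t < m ∧ cyclicExchange x a b r.1 r.2 t = v := by
    intro r v hv hvx hvy
    obtain ⟨t, ht, rfl⟩ := (hWs r v).1 hv
    refine ⟨t, ?_, lt_of_le_of_ne ht ?_, rfl⟩
    · rintro rfl
      exact hvx (by simp [cyclicExchange, cyclicInterval_zero])
    · rintro rfl
      exact hvy (cyclicExchange_self ha hb hx hy _ _)
  let P : (ZMod m × ZMod m) ⊕ {c // c ∈ (symmDiff x y)ᶜ} → (johnson α).Path x y :=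
    Sum.elim (fun r => ⟨W r, hWp r⟩) (fun c => ⟨T c, hTp c⟩)
  -- At `c`, inner vertices of `T c` differ from `x`, whereas those of `W r` agree with it.
  have hWT : ∀ r c v, v ∈ (W r).support → v ∈ (T c).support → v = x ∨ v = y := by
    intro r c v h₁ h₂
    by_contra! h
    obtain ⟨t, -, -, rfl⟩ := hWi r v h₁ h.1 h.2
    have hc' : (c : α) ∈ x ↔ (c : α) ∈ y := by
      have := c.2
      simp only [mem_compl, mem_symmDiff] at this
      tauto
    exact (hTs c _ h₂ h.1 h.2 c hc').1 (mem_cyclicExchange_of_mem_iff ha hb _ _ _ hc') rfl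
  have hP : ∀ i j, i ≠ j → ∀ v, v ∈ (P i : (johnson α).Walk x y).support →
      v ∈ (P j : (johnson α).Walk x y).support → v = x ∨ v = y := by
    rintro (r | c) (s | c') hij v h₁ h₂
    · by_contra! h
      obtain ⟨t, ht, htm, rfl⟩ := hWi r v h₁ h.1 h.2
      obtain ⟨t', ht', htm', h'⟩ := hWi s _ h₂ h.1 h.2
      obtain ⟨h₃, h₄⟩ := (cyclicExchange_eq ha hb htm.le htm'.le h'.symm).2 ht htm.ne
      exact hij (congrArg Sum.inl (Prod.ext h₃ h₄))
    · exact hWT r c' v h₁ h₂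
    · exact hWT s c v h₂ h₁
    · by_contra! h
      have hc' : (c : α) ∈ x ↔ (c : α) ∈ y := by
        have := c.2
        simp only [mem_compl, mem_symmDiff] at this
        tauto
      have h₃ := hTs c v h₁ h.1 h.2 c hc'
      have h₄ := hTs c' v h₂ h.1 h.2 c hc'
      have : (c : α) = c' := by
        by_contra hne
        exact h₃.1 (h₄.2 hne) rfl
      exact hij (congrArg Sum.inr (Subtype.ext this))
  -- Disjointness separates paths that have an inner vertex. Only for `m = 1` does a cyclic path
  -- have none, and then there is just one.
  have hPi : Function.Injective P := by
    have key : ∀ i j, i ≠ j → (∃ v ∈ (P i : (johnson α).Walk x y).support, v ≠ x ∧ v ≠ y) →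
        P i ≠ P j := by
      rintro i j hij ⟨v, hv, hvx, hvy⟩ h
      rcases hP i j hij v hv (h ▸ hv) with h | h
      · exact hvx h
      · exact hvy h
    intro i j h
    by_contra hij
    rcases i with r | c
    · rcases j with s | c
      · have hm1 : m ≠ 1 := by
          rintro rfl
          exact hij (congrArg Sum.inl (Subsingleton.elim r s))
        refine key _ _ hij ⟨cyclicExchange x a b r.1 r.2 1, (hWs r _).2 ⟨1, by omega, rfl⟩,
          fun h' => ?_, fun h' => ?_⟩ h
        · have := (cyclicExchange_eq ha hb (p := r.1) (q := r.2) (p' := r.1) (q' := r.2)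
            (t := 1) (t' := 0) (by omega) (by omega)
            (h'.trans (by simp [cyclicExchange, cyclicInterval_zero]))).1
          omega
        · have := (cyclicExchange_eq ha hb (p := r.1) (q := r.2) (p' := r.1) (q' := r.2)
            (t := 1) (t' := m) (by omega) (by omega)
            (h'.trans (cyclicExchange_self ha hb hx hy _ _).symm)).1
          omega
      · exact key _ _ (Ne.symm hij) (hTi c) h.symm
    · exact key _ _ hij (hTi c) h
  have hcard : Fintype.card (Fin (Fintype.card α - 1)) ≤
      Fintype.card ((ZMod m × ZMod m) ⊕ {c // c ∈ (symmDiff x y)ᶜ}) := by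
    have h₁ : (symmDiff x y).card = m + m := by
      rw [symmDiff_def, sup_eq_union, card_union_of_disjoint disjoint_sdiff_sdiff, hx, hy]
    have h₂ := card_add_card_compl (symmDiff x y)
    rw [h₁] at h₂
    rw [Fintype.card_fin, Fintype.card_sum, Fintype.card_prod, ZMod.card, Fintype.card_coe]
    -- This is `(m - 1)² ≥ 0`.
    have h₃ : m + m ≤ m * m + 1 := by
      obtain ⟨l, rfl⟩ := Nat.exists_eq_succ_of_ne_zero hm
      nlinarith [Nat.zero_le (l * l)]
    omega
  obtain ⟨g⟩ := Function.Embedding.nonempty_of_card_le hcard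
  exact ⟨P ∘ g, hPi.comp g.injective, fun i j hij => hP _ _ (g.injective.ne hij)⟩

/-! ### Transfer to the hypersimplex -/

section Hypersimplex

variable {d k : ℕ}

/-- The `(0,1)`-vector with support `s`. -/
def indicatorVector (s : Finset (Fin d)) : Fin d → ℝ := fun i => if i ∈ s then 1 else 0

theorem sum_indicatorVector (s t : Finset (Fin d)) :
    ∑ i ∈ t, indicatorVector s i = ((t ∩ s).card : ℝ) := by
  simp [indicatorVector]

theorem setOf_zero_one_sum_eq : {x : Fin d → ℝ | (∀ i, x i = 0 ∨ x i = 1) ∧ ∑ i, x i = (k : ℝ)} =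
    indicatorVector '' {s | s.card = k} := by
  ext x
  constructor
  · rintro ⟨h, hs⟩
    have hx : indicatorVector (univ.filter fun i => x i = 1) = x := by
      ext i
      rcases h i with h | h <;> simp [indicatorVector, h]
    refine ⟨_, ?_, hx⟩
    rw [← hx, sum_indicatorVector, univ_inter] at hs
    exact_mod_cast hs
  · rintro ⟨s, hs, rfl⟩
    refine ⟨fun i => ?_, ?_⟩
    · by_cases h : i ∈ s <;> simp [indicatorVector, h]
    · rw [sum_indicatorVector, univ_inter, hs]

theorem indicatorVector_mem_extremePoints_Icc (s : Finset (Fin d)) :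
    indicatorVector s ∈ (Set.Icc (0 : Fin d → ℝ) 1).extremePoints ℝ := by
  refine ⟨⟨fun i => ?_, fun i => ?_⟩, ?_⟩
  · by_cases h : i ∈ s <;> simp [indicatorVector, h]
  · by_cases h : i ∈ s <;> simp [indicatorVector, h]
  · rintro u hu v hv ⟨p, q, hp, hq, hpq, h⟩
    ext i
    have h₁ := congrFun h i
    have hu0 := hu.1 i
    have hu1 := hu.2 i
    have hv0 := hv.1 i
    have hv1 := hv.2 i
    simp only [Pi.add_apply, Pi.smul_apply, smul_eq_mul, Pi.zero_apply, Pi.one_apply] at *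
    by_cases hi : i ∈ s
    · simp only [indicatorVector, hi, if_true] at h₁ ⊢
      have : p * (1 - u i) ≤ 0 := by nlinarith
      have := nonpos_of_mul_nonpos_right this hp
      linarith
    · simp only [indicatorVector, hi, if_false] at h₁ ⊢
      have : p * u i ≤ 0 := by nlinarith
      have := nonpos_of_mul_nonpos_right this hp
      linarith

/-- The generators are vertices of the unit cube, so they remain extreme in the smaller hull. -/
theorem extremePoints_hypersimplex :
    (hypersimplex d k).extremePoints ℝ = indicatorVector '' {s | s.card = k} := by
  rw [hypersimplex, setOf_zero_one_sum_eq]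
  refine Set.Subset.antisymm extremePoints_convexHull_subset ?_
  have hsub : convexHull ℝ (indicatorVector '' {s : Finset (Fin d) | s.card = k}) ⊆
      Set.Icc (0 : Fin d → ℝ) 1 := by
    refine convexHull_min ?_ (convex_Icc 0 1)
    rintro _ ⟨s, -, rfl⟩
    exact (indicatorVector_mem_extremePoints_Icc s).1
  intro x hx
  refine inter_extremePoints_subset_extremePoints_of_subset hsub ⟨subset_convexHull ℝ _ hx, ?_⟩
  obtain ⟨s, -, rfl⟩ := hx
  exact indicatorVector_mem_extremePoints_Icc s

theorem card_inter_lt_of_ne {s t : Finset (Fin d)} (h : s.card = t.card) (hne : s ≠ t) :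
    (s ∩ t).card < s.card := by
  obtain ⟨i, hs, ht⟩ := exists_mem_notMem_of_card_eq h hne
  exact card_lt_card ((ssubset_iff_of_subset inter_subset_left).2 ⟨i, hs, by simp [ht]⟩)

/-- The functional `g` equals `2k - 1` at both ends, as `|s ∩ t| = k - 1`. Any other `k`-set meets
each of `s` and `t` in at most `k - 1` elements, so `g ≤ 2k - 2` on the hull of the remaining
vertices. -/
theorem hypersimplexGraph_adj_of_johnson_adj {s t : Finset (Fin d)}
    (h : (johnson (Fin d)).Adj s t) {u v : (hypersimplex d k).extremePoints ℝ}
    (hs : s.card = k) (hu : (u : Fin d → ℝ) = indicatorVector s)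
    (hv : (v : Fin d → ℝ) = indicatorVector t) : (hypersimplexGraph d k).Adj u v := by
  let g : (Fin d → ℝ) →ₗ[ℝ] ℝ := ∑ i ∈ s, LinearMap.proj i + ∑ i ∈ t, LinearMap.proj i
  have hg : ∀ r, g (indicatorVector r) = ((s ∩ r).card : ℝ) + ((t ∩ r).card : ℝ) := by
    intro r
    rw [← sum_indicatorVector, ← sum_indicatorVector]
    simp [g]
  have ht : t.card = k := (johnson_adj_card_eq h).symm.trans hs
  have hst : ((s ∩ t).card : ℝ) = k - 1 := by
    have h₁ := card_sdiff_add_card_inter s t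
    rw [h.1, hs] at h₁
    rw [← h₁]
    push_cast
    ring
  have hgs : g (indicatorVector s) = 2 * k - 1 := by
    rw [hg, inter_self, inter_comm, hst, hs]
    ring
  have hgt : g (indicatorVector t) = 2 * k - 1 := by
    rw [hg, inter_self, hst, ht]
    ring
  refine ⟨fun huv => h.ne ?_, ?_⟩
  · have h₁ : indicatorVector s = indicatorVector t := by rw [← hu, ← hv, huv]
    ext i
    have h₂ := congrFun h₁ i
    by_cases hi : i ∈ s <;> by_cases hj : i ∈ t <;> simp_all [indicatorVector]
  · rw [Set.disjoint_left]
    rintro _ ⟨p, q, hp, hq, hpq, rfl⟩ hmem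
    have hsub : convexHull ℝ ((hypersimplex d k).extremePoints ℝ \ {(u : Fin d → ℝ), ↑v}) ⊆
        {z | g z ≤ 2 * k - 2} := by
      refine convexHull_min ?_ (convex_halfSpace_le g.isLinear _)
      rintro z ⟨hz, hruv⟩
      obtain ⟨r, hr, rfl⟩ := extremePoints_hypersimplex.subset hz
      have hr : r.card = k := hr
      rw [hu, hv] at hruv
      have hrs : s ≠ r := fun h => hruv (by simp [h])
      have hrt : t ≠ r := fun h => hruv (by simp [h])
      have h₁ := card_inter_lt_of_ne (hs.trans hr.symm) hrs
      have h₂ := card_inter_lt_of_ne (ht.trans hr.symm) hrt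
      rw [hs] at h₁
      rw [ht] at h₂
      rw [Set.mem_ofPred_eq, hg]
      have h₁ : ((s ∩ r).card : ℝ) + 1 ≤ k := by exact_mod_cast h₁
      have h₂ : ((t ∩ r).card : ℝ) + 1 ≤ k := by exact_mod_cast h₂
      linarith
    have h₁ := hsub hmem
    rw [Set.mem_ofPred_eq, map_add, map_smul, map_smul, hu, hv, hgs, hgt, ← add_smul, hpq,
      one_smul] at h₁
    linarith

/-- The support of a vertex of the hypersimplex. -/
noncomputable def vertexSupport (u : (hypersimplex d k).extremePoints ℝ) : Finset (Fin d) :=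
  univ.filter fun i => (u : Fin d → ℝ) i = 1

theorem vertexSupport_eq {u : (hypersimplex d k).extremePoints ℝ} {s : Finset (Fin d)}
    (h : (u : Fin d → ℝ) = indicatorVector s) : vertexSupport u = s := by
  ext i
  simp [vertexSupport, h, indicatorVector]

theorem indicatorVector_vertexSupport (u : (hypersimplex d k).extremePoints ℝ) :
    (u : Fin d → ℝ) = indicatorVector (vertexSupport u) := by
  obtain ⟨s, -, hs⟩ := extremePoints_hypersimplex.subset u.2
  rw [vertexSupport_eq hs.symm, hs]

theorem card_vertexSupport (u : (hypersimplex d k).extremePoints ℝ) :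
    (vertexSupport u).card = k := by
  obtain ⟨s, hc, hs⟩ := extremePoints_hypersimplex.subset u.2
  rw [vertexSupport_eq hs.symm, hc]

theorem vertexSupport_injective :
    Function.Injective (vertexSupport : (hypersimplex d k).extremePoints ℝ → _) := by
  intro u v h
  apply Subtype.ext
  rw [indicatorVector_vertexSupport, h, ← indicatorVector_vertexSupport]

/-- Exchanges preserve cardinality, so the walk never leaves the `k`-sets. Matching the support
lists transfers simplicity, disjointness and spanning at once. -/
theorem exists_walk_of_johnson_walk {s t : Finset (Fin d)} (p : (johnson (Fin d)).Walk s t)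
    {u v : (hypersimplex d k).extremePoints ℝ} (hu : vertexSupport u = s)
    (hv : vertexSupport v = t) :
    ∃ q : (hypersimplexGraph d k).Walk u v, q.support.map vertexSupport = p.support := by
  induction p generalizing u with
  | nil =>
    obtain rfl := vertexSupport_injective (hu.trans hv.symm)
    exact ⟨.nil, by simp [hu]⟩
  | @cons s r t h p ih =>
    have hs : s.card = k := hu ▸ card_vertexSupport u
    have hr : r.card = k := (johnson_adj_card_eq h).symm.trans hs
    let w : (hypersimplex d k).extremePoints ℝ :=
      ⟨indicatorVector r, extremePoints_hypersimplex.superset ⟨r, hr, rfl⟩⟩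
    obtain ⟨q, hq⟩ := ih (u := w) (vertexSupport_eq rfl) hv
    have hadj : (hypersimplexGraph d k).Adj u w :=
      hypersimplexGraph_adj_of_johnson_adj h hs (hu ▸ indicatorVector_vertexSupport u) rfl
    exact ⟨.cons hadj q, by simp [hq, hu]⟩

theorem hypersimplexGraph_isVertexConnected :
    IsVertexConnected (hypersimplexGraph d k) (d - 1) := by
  intro u v huv
  obtain ⟨P, hP, hPd⟩ := Fintype.card_fin d ▸ exists_disjoint_paths
    ((card_vertexSupport u).trans (card_vertexSupport v).symm) (vertexSupport_injective.ne huv)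
  choose Q hQ using fun i => exists_walk_of_johnson_walk
    (P i : (johnson (Fin d)).Walk (vertexSupport u) (vertexSupport v)) rfl rfl
  have hQp : ∀ i, (Q i).IsPath := fun i => by
    rw [SimpleGraph.Walk.isPath_def]
    exact List.Nodup.of_map vertexSupport (hQ i ▸ (P i).2.support_nodup)
  refine ⟨fun i => ⟨Q i, hQp i⟩, fun i j h => hP (Subtype.ext ?_), fun i j hij w hi hj => ?_⟩
  · apply SimpleGraph.Walk.ext_support
    rw [← hQ i, ← hQ j, show Q i = Q j from congrArg Subtype.val h]
  · have mem : ∀ l, w ∈ (Q l).support →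
        vertexSupport w ∈
          (P l : (johnson (Fin d)).Walk (vertexSupport u) (vertexSupport v)).support := fun l hl => by
      rw [← hQ l]
      exact List.mem_map_of_mem hl
    exact (hPd i j hij _ (mem i hi) (mem j hj)).imp (fun h => vertexSupport_injective h)
      (fun h => vertexSupport_injective h)

theorem hypersimplexGraph_isHamiltonConnected :
    IsHamiltonConnected (hypersimplexGraph d k) := by
  refine isHamiltonConnected_of_exists_isPath fun u v huv => ?_
  have hmem : ∀ w : (hypersimplex d k).extremePoints ℝ, vertexSupport w ∈ slice ∅ univ k :=
    fun w => ⟨empty_subset _, subset_univ _, card_vertexSupport w⟩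
  obtain ⟨p, hp, hs⟩ := exists_hamiltonian_path_slice ∅ univ k _ _ (hmem u) (hmem v)
    (.inl (vertexSupport_injective.ne huv))
  obtain ⟨q, hq⟩ := exists_walk_of_johnson_walk p rfl rfl
  have hqp : q.IsPath := by
    rw [SimpleGraph.Walk.isPath_def]
    exact List.Nodup.of_map vertexSupport (hq ▸ hp.support_nodup)
  refine ⟨q, hqp, fun w => ?_⟩
  have h₁ := (hs _).2 (hmem w)
  rw [← hq, List.mem_map_of_injective vertexSupport_injective] at h₁
  exact h₁

end Hypersimplex

end HypersimplexGraph

theorem proposition6 (d k : ℕ) (hk : 1 ≤ k) (hkd : (k : ℝ) ≤ (d : ℝ) / 2) :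
    HypersimplexGraph.IsVertexConnected (HypersimplexGraph.hypersimplexGraph d k) (d - 1) ∧
      HypersimplexGraph.IsHamiltonConnected (HypersimplexGraph.hypersimplexGraph d k) := by
  exact ⟨HypersimplexGraph.hypersimplexGraph_isVertexConnected,
    HypersimplexGraph.hypersimplexGraph_isHamiltonConnected⟩
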